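/- Let $r>0$ and $f(x)=r(e^{x}-1)$, and consider the distributed delay differential equation $$x'(t)=-\int_0^1 f(x(t-s))\,ds,\qquad t\in\mathbb R. \tag{1}$$ Call a solution $x:\mathbb R\to\mathbb R$ of (1) a *special symmetric periodic solution* (SSPS) if its minimal period is $2$ and $x(t)+x(t-1)$ is constant in $t\in\mathbb R$. For $k\in(0,1)$ let $$K(k)=\int_0^{\pi/2}\frac{d\theta}{\sqrt{1-k^2\sin^2\theta}},\qquad E(k)=\int_0^{\pi/2}\sqrt{1-k^2\sin^2\theta}\,d\theta$$ be the complete elliptic integrals of the first and second kind, and let $\mathrm{cn}(\cdot,k)$, $\mathrm{dn}(\cdot,k)$ be the Jacobi elliptic functions with modulus $k$. Then (1) has an SSPS if and only if $r>\pi^2/2$. Moreover, if $r>\pi^2/2$, then the equation $$r=2K(k)\bigl(2E(k)-K(k)(1-k^2)\bigr)$$ has a unique solution $k\in(0,1)$, and, for this $k$, the function $$x(t)=\log\left(\frac{K(k)\bigl(\mathrm{dn}(2K(k)t,k)+k\,\mathrm{cn}(2K(k)t,k)\bigr)^2}{2E(k)-K(k)(1-k^2)}\right)$$ is an SSPS of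 (1), and every SSPS of (1) is a time translate $t\mapsto x(t+t_0)$, $t_0\in\mathbb R$, of it. -/

import Mathlib

noncomputable section

/-- `x : ℝ → ℝ` solves the distributed delay equation `x'(t) = -∫₀¹ f(x(t - s)) ds` on all of `ℝ`. -/
def IsDelaySolution (f x : ℝ → ℝ) : Prop :=
  ∀ t : ℝ, HasDerivAt x (-∫ s in (0 : ℝ)..1, f (x (t - s))) t

/-- A special symmetric periodic solution of the distributed delay equation with nonlinearity `f`
(not assumed odd): a solution whose minimal period is `2` and for which `x(t) + x(t - 1)` is
constant. -/
structure IsSSPS (f x : ℝ → ℝ) : Prop where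
  solution : IsDelaySolution f x
  minimal_period : IsLeast {T : ℝ | 0 < T ∧ Function.Periodic x T} 2
  symmetric : ∃ c : ℝ, ∀ t : ℝ, x t + x (t - 1) = c

/-- Incomplete elliptic integral of the first kind, as a function of the modulus `k` and the
amplitude `φ`. -/
def ellipticF (k φ : ℝ) : ℝ :=
  ∫ θ in (0 : ℝ)..φ, 1 / √(1 - k ^ 2 * Real.sin θ ^ 2)

/-- Complete elliptic integral of the first kind with modulus `k`. -/
def ellipticK (k : ℝ) : ℝ := ellipticF k (Real.pi / 2)

/-- Complete elliptic integral of the second kind with modulus `k`. -/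
def ellipticE (k : ℝ) : ℝ :=
  ∫ θ in (0 : ℝ)..(Real.pi / 2), √(1 - k ^ 2 * Real.sin θ ^ 2)

/-- For a modulus `k ∈ (0, 1)` the map `φ ↦ F(φ, k)` is a bijection of `ℝ`, so that its inverse,
the Jacobi amplitude, is a genuine inverse. -/
theorem ellipticF_bijective {k : ℝ} (hk : k ∈ Set.Ioo (0 : ℝ) 1) :
    Function.Bijective (ellipticF k) := by
  have hpos : ∀ θ : ℝ, 0 < 1 - k ^ 2 * Real.sin θ ^ 2 := fun θ => by
    have h1 := Real.sin_sq_le_one θ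
    have h2 : k ^ 2 < 1 := by nlinarith [hk.1, hk.2]
    nlinarith [sq_nonneg k, sq_nonneg (Real.sin θ)]
  have hge : ∀ θ : ℝ, 1 ≤ 1 / √(1 - k ^ 2 * Real.sin θ ^ 2) := fun θ => by
    rw [le_div_iff₀ (Real.sqrt_pos.2 (hpos θ)), one_mul]
    exact Real.sqrt_le_one.2 (by nlinarith [mul_nonneg (sq_nonneg k) (sq_nonneg (Real.sin θ))])
  have hcont : Continuous fun θ : ℝ => 1 / √(1 - k ^ 2 * Real.sin θ ^ 2) :=
    continuous_const.div (by fun_prop) fun θ => (Real.sqrt_pos.2 (hpos θ)).ne'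
  have hder : ∀ φ, HasDerivAt (ellipticF k) (1 / √(1 - k ^ 2 * Real.sin φ ^ 2)) φ := fun φ =>
    (hcont.integral_hasStrictDerivAt 0 φ).hasDerivAt
  have hmono : Monotone fun φ => ellipticF k φ - φ :=
    monotone_of_hasDerivAt_nonneg (fun φ => (hder φ).sub (hasDerivAt_id φ)) fun φ => by
      simpa using hge φ
  have h0 : ellipticF k 0 = 0 := by simp [ellipticF]
  constructor
  · refine StrictMono.injective fun a b hab => ?_
    have := hmono hab.le
    simp only at this
    linarith
  · refine Continuous.surjective (continuous_iff_continuousAt.2 fun φ => (hder φ).continuousAt) ?_ ?_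
    · refine Filter.tendsto_atTop_mono' _ ?_ Filter.tendsto_id
      filter_upwards [Filter.eventually_ge_atTop 0] with φ hφ
      have := hmono hφ
      simp only [h0, id] at this ⊢
      linarith
    · refine Filter.tendsto_atBot_mono' _ ?_ Filter.tendsto_id
      filter_upwards [Filter.eventually_le_atBot 0] with φ hφ
      have := hmono hφ
      simp only [h0, id] at this ⊢
      linarith

/-- Jacobi amplitude `am(u, k)`: the inverse of `φ ↦ F(φ, k)`. -/
def jacobiAm (u k : ℝ) : ℝ := Function.invFun (ellipticF k) u

/-- Jacobi elliptic function `sn(u, k)`. -/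
def jacobiSn (u k : ℝ) : ℝ := Real.sin (jacobiAm u k)

/-- Jacobi elliptic function `cn(u, k)`. -/
def jacobiCn (u k : ℝ) : ℝ := Real.cos (jacobiAm u k)

/-- Jacobi elliptic function `dn(u, k)`. -/
def jacobiDn (u k : ℝ) : ℝ := √(1 - k ^ 2 * jacobiSn u k ^ 2)

/-- The explicit profile with modulus `k`. -/
def logisticProfile (k t : ℝ) : ℝ :=
  Real.log (ellipticK k *
      (jacobiDn (2 * ellipticK k * t) k + k * jacobiCn (2 * ellipticK k * t) k) ^ 2 /
    (2 * ellipticE k - ellipticK k * (1 - k ^ 2)))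

end

/-! Differentiating (1) gives `x'' = -(f(x(t)) - f(x(t-1)))`. When `x(t-1) = c - x(t)`, this is the
autonomous equation `x'' = -r(e^x - e^{c-x})`, a sinh-type pendulum about `c/2`. The functions `a +
2 log(dn + k cn)(ωt + b)` solve it for suitable `a` and `ω`. Matching value and slope at a maximum
of an SSPS, ODE uniqueness places the SSPS in this family (`secondOrder_solution_unique`,
`hasDerivAt_deriv_profile`). Minimal period 2 forces `ω = 2K`, since `2 log(dn + k cn)` has minimal
period `4K`.

Differentiation loses a constant, so the member must be put back into (1). With `D = 2E - K(1-k²)`,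
the delayed integral is affine in `sn`, and comparing coefficients gives `e^a = K/D` and `r = 2KD`
(`integral_feedback`, `eq_of_isDelaySolution`). Conversely, these values give an SSPS.

The threshold and the uniqueness of `k` come from `2KD` being continuous and strictly increasing on
`[0, 1)`, equal to `π²/2` at `0` and unbounded near `1`. -/

noncomputable section

open Real

/-! ### Elliptic integrals and their increments over `π` -/

/-- The elliptic radical `√(1 - k² sin² θ)`. -/
def ellipticDelta (k θ : ℝ) : ℝ := √(1 - k ^ 2 * sin θ ^ 2)

/-- Incomplete elliptic integral of the second kind. -/
def ellipticEInc (k φ : ℝ) : ℝ := ∫ θ in (0 : ℝ)..φ, ellipticDelta k θ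

/-- The combination `2 E(k) - K(k) (1 - k²)`. -/
def ellipticD (k : ℝ) : ℝ := 2 * ellipticE k - ellipticK k * (1 - k ^ 2)

theorem ellipticK_eq (k : ℝ) : ellipticK k = ∫ θ in (0 : ℝ)..(π / 2), 1 / ellipticDelta k θ := rfl

theorem ellipticE_eq (k : ℝ) : ellipticE k = ∫ θ in (0 : ℝ)..(π / 2), ellipticDelta k θ := rfl

theorem one_sub_sq_mul_sin_sq_pos {k : ℝ} (hk : k ^ 2 < 1) (θ : ℝ) :
    0 < 1 - k ^ 2 * sin θ ^ 2 := by
  nlinarith [sin_sq_le_one θ, sq_nonneg k, sq_nonneg (sin θ)]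

theorem ellipticDelta_pos {k : ℝ} (hk : k ^ 2 < 1) (θ : ℝ) : 0 < ellipticDelta k θ :=
  sqrt_pos.2 (one_sub_sq_mul_sin_sq_pos hk θ)

theorem ellipticDelta_sq {k : ℝ} (hk : k ^ 2 < 1) (θ : ℝ) :
    ellipticDelta k θ ^ 2 = 1 - k ^ 2 * sin θ ^ 2 :=
  sq_sqrt (one_sub_sq_mul_sin_sq_pos hk θ).le

theorem continuous_ellipticDelta (k : ℝ) : Continuous (ellipticDelta k) := by
  unfold ellipticDelta; fun_prop

theorem continuous_inv_ellipticDelta {k : ℝ} (hk : k ^ 2 < 1) :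
    Continuous fun θ => 1 / ellipticDelta k θ :=
  continuous_const.div (continuous_ellipticDelta k) fun θ => (ellipticDelta_pos hk θ).ne'

theorem hasDerivAt_ellipticDelta {k : ℝ} (hk : k ^ 2 < 1) (θ : ℝ) :
    HasDerivAt (ellipticDelta k) (-(k ^ 2 * sin θ * cos θ) / ellipticDelta k θ) θ := by
  have h := ((((hasDerivAt_sin θ).pow 2).const_mul (k ^ 2)).const_sub 1).sqrt
    (one_sub_sq_mul_sin_sq_pos hk θ).ne'
  refine h.congr_deriv ?_
  have := (ellipticDelta_pos hk θ).ne'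
  change _ / (2 * ellipticDelta k θ) = _
  field_simp
  ring

theorem ellipticDelta_add_pi (k θ : ℝ) : ellipticDelta k (θ + π) = ellipticDelta k θ := by
  simp [ellipticDelta, sin_add_pi]

theorem ellipticDelta_pi_sub (k θ : ℝ) : ellipticDelta k (π - θ) = ellipticDelta k θ := by
  simp [ellipticDelta, sin_pi_sub]

theorem integral_add_pi_of_symmetric {g : ℝ → ℝ} (hg : Continuous g)
    (hper : Function.Periodic g π) (hsymm : ∀ θ, g (π - θ) = g θ) (φ : ℝ) :
    ∫ θ in (0 : ℝ)..(φ + π), g θ = (∫ θ in (0 : ℝ)..φ, g θ) + 2 * ∫ θ in (0 : ℝ)..(π / 2), g θ := by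
  have hi : ∀ a b, IntervalIntegrable g MeasureTheory.volume a b := hg.intervalIntegrable
  rw [hper.intervalIntegral_add_eq_add 0 φ hi, zero_add,
    ← intervalIntegral.integral_add_adjacent_intervals (hi 0 (π / 2)) (hi (π / 2) π)]
  have h : ∫ θ in (π / 2)..π, g θ = ∫ θ in (0 : ℝ)..(π / 2), g θ := by
    have := intervalIntegral.integral_comp_sub_left (a := π / 2) (b := π) g π
    simp only [hsymm, sub_self] at this
    rw [this]; congr 1; ring
  rw [h]; ring

theorem ellipticF_add_pi {k : ℝ} (hk : k ^ 2 < 1) (φ : ℝ) :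
    ellipticF k (φ + π) = ellipticF k φ + 2 * ellipticK k :=
  integral_add_pi_of_symmetric (continuous_inv_ellipticDelta hk)
    (fun θ => by simp only [ellipticDelta_add_pi])
    (fun θ => by simp only [ellipticDelta_pi_sub]) φ

theorem ellipticEInc_add_pi (k φ : ℝ) :
    ellipticEInc k (φ + π) = ellipticEInc k φ + 2 * ellipticE k :=
  integral_add_pi_of_symmetric (continuous_ellipticDelta k)
    (ellipticDelta_add_pi k) (ellipticDelta_pi_sub k) φ

theorem hasDerivAt_ellipticF {k : ℝ} (hk : k ^ 2 < 1) (φ : ℝ) :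
    HasDerivAt (ellipticF k) (1 / ellipticDelta k φ) φ :=
  ((continuous_inv_ellipticDelta hk).integral_hasStrictDerivAt 0 φ).hasDerivAt

theorem hasDerivAt_ellipticEInc (k φ : ℝ) :
    HasDerivAt (ellipticEInc k) (ellipticDelta k φ) φ :=
  ((continuous_ellipticDelta k).integral_hasStrictDerivAt 0 φ).hasDerivAt

theorem strictMono_ellipticF {k : ℝ} (hk : k ^ 2 < 1) : StrictMono (ellipticF k) :=
  strictMono_of_hasDerivAt_pos (hasDerivAt_ellipticF hk)
    fun φ => one_div_pos.2 (ellipticDelta_pos hk φ)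

theorem ellipticF_zero (k : ℝ) : ellipticF k 0 = 0 := by simp [ellipticF]

theorem ellipticK_pos {k : ℝ} (hk : k ^ 2 < 1) : 0 < ellipticK k := by
  rw [← ellipticF_zero k]
  exact strictMono_ellipticF hk (by positivity)

theorem sq_lt_one_of_mem_Ioo {k : ℝ} (hk : k ∈ Set.Ioo (0 : ℝ) 1) : k ^ 2 < 1 := by
  nlinarith [hk.1, hk.2]

/-! ### Monotonicity and range of `2KD` -/

/-- Since `Δ² - (1 - k²) = k² cos² θ`, the integrand `2Δ - (1 - k²)/Δ` takes a form that is visibly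
positive. -/
theorem ellipticD_eq_integral {k : ℝ} (hk : k ^ 2 < 1) :
    ellipticD k = ∫ θ in (0 : ℝ)..(π / 2),
      (ellipticDelta k θ + k ^ 2 * cos θ ^ 2 / ellipticDelta k θ) := by
  have h1 := (continuous_ellipticDelta k).intervalIntegrable (μ := MeasureTheory.volume) 0 (π / 2)
  have h2 := (continuous_inv_ellipticDelta hk).intervalIntegrable
    (μ := MeasureTheory.volume) 0 (π / 2)
  rw [ellipticD, ellipticE_eq, ellipticK_eq, ← intervalIntegral.integral_const_mul,
    ← intervalIntegral.integral_mul_const,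
    ← intervalIntegral.integral_sub (h1.const_mul 2) (h2.mul_const _)]
  refine intervalIntegral.integral_congr fun θ _ => ?_
  have hp := (ellipticDelta_pos hk θ).ne'
  have hs := ellipticDelta_sq hk θ
  have := sin_sq_add_cos_sq θ
  field_simp
  rw [hs]
  linear_combination -k ^ 2 * this

theorem one_le_ellipticD {k : ℝ} (hk : k ^ 2 < 1) : 1 ≤ ellipticD k := by
  rw [ellipticD_eq_integral hk, show (1 : ℝ) = ∫ θ in (0 : ℝ)..(π / 2), cos θ by simp]
  refine intervalIntegral.integral_mono_on (by positivity)
    (continuous_cos.intervalIntegrable _ _) ?_ fun θ _ => ?_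
  · refine Continuous.intervalIntegrable ?_ _ _
    exact (continuous_ellipticDelta k).add (((continuous_cos.pow 2).const_mul _).div
      (continuous_ellipticDelta k) fun θ => (ellipticDelta_pos hk θ).ne')
  · have hp := ellipticDelta_pos hk θ
    have : cos θ ≤ ellipticDelta k θ := by
      refine le_sqrt_of_sq_le ?_
      nlinarith [sin_sq_add_cos_sq θ, sq_nonneg (sin θ)]
    have : 0 ≤ k ^ 2 * cos θ ^ 2 / ellipticDelta k θ := by positivity
    linarith

theorem ellipticD_pos {k : ℝ} (hk : k ^ 2 < 1) : 0 < ellipticD k :=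
  one_pos.trans_le (one_le_ellipticD hk)

theorem ellipticDelta_strictAnti {k l : ℝ} (hkl : k ^ 2 < l ^ 2) (hl : l ^ 2 < 1) {θ : ℝ}
    (hθ : sin θ ≠ 0) : ellipticDelta l θ < ellipticDelta k θ := by
  refine sqrt_lt_sqrt (one_sub_sq_mul_sin_sq_pos hl θ).le ?_
  have := mul_lt_mul_of_pos_right hkl (sq_pos_of_ne_zero hθ)
  linarith

theorem ellipticK_lt {k l : ℝ} (hkl : k ^ 2 < l ^ 2) (hl : l ^ 2 < 1) :
    ellipticK k < ellipticK l := by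
  rw [ellipticK_eq, ellipticK_eq]
  have hle : ∀ θ, 1 / ellipticDelta k θ ≤ 1 / ellipticDelta l θ := fun θ =>
    one_div_le_one_div_of_le (ellipticDelta_pos hl θ)
      (sqrt_le_sqrt (by nlinarith [mul_le_mul_of_nonneg_right hkl.le (sq_nonneg (sin θ))]))
  refine intervalIntegral.integral_lt_integral_of_continuousOn_of_le_of_exists_lt (by positivity)
    (continuous_inv_ellipticDelta (hkl.trans hl)).continuousOn
    (continuous_inv_ellipticDelta hl).continuousOn (fun θ _ => hle θ)
    ⟨π / 2, ⟨by positivity, le_rfl⟩, ?_⟩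
  exact one_div_lt_one_div_of_lt (ellipticDelta_pos hl _)
    (ellipticDelta_strictAnti hkl hl (by simp))

/-- The integrands are not ordered pointwise: at `θ = π/2` the order is reversed. Their difference
is instead a nonnegative function `q` plus an exact derivative `h'` with `h` vanishing at both
endpoints. -/
theorem ellipticD_le {k l : ℝ} (hkl : k ^ 2 < l ^ 2) (hl : l ^ 2 < 1) :
    ellipticD k ≤ ellipticD l := by
  have hk := hkl.trans hl
  have hc : ∀ {k : ℝ}, k ^ 2 < 1 →
      Continuous fun θ => ellipticDelta k θ + k ^ 2 * cos θ ^ 2 / ellipticDelta k θ :=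
    fun {k} hk => (continuous_ellipticDelta k).add (((continuous_cos.pow 2).const_mul _).div
      (continuous_ellipticDelta k) fun θ => (ellipticDelta_pos hk θ).ne')
  rw [ellipticD_eq_integral hk, ellipticD_eq_integral hl, ← sub_nonneg,
    ← intervalIntegral.integral_sub ((hc hl).intervalIntegrable _ _)
      ((hc hk).intervalIntegrable _ _)]
  -- These are `q = cot² θ (Δ_k - Δ_l)` and `h = cot θ (Δ_k - Δ_l)`, rationalised so that they are
  -- regular at `θ = 0`.
  set q : ℝ → ℝ := fun θ =>
    (l ^ 2 - k ^ 2) * cos θ ^ 2 / (ellipticDelta k θ + ellipticDelta l θ) with hq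
  set h : ℝ → ℝ := fun θ =>
    (l ^ 2 - k ^ 2) * (sin θ * cos θ) / (ellipticDelta k θ + ellipticDelta l θ) with hh
  have hsum : ∀ θ, 0 < ellipticDelta k θ + ellipticDelta l θ := fun θ =>
    add_pos (ellipticDelta_pos hk θ) (ellipticDelta_pos hl θ)
  have hqc : Continuous q := ((continuous_cos.pow 2).const_mul _).div
    ((continuous_ellipticDelta k).add (continuous_ellipticDelta l)) fun θ => (hsum θ).ne'
  have hq0 : ∀ θ, 0 ≤ q θ := fun θ =>
    div_nonneg (mul_nonneg (sub_nonneg.2 hkl.le) (sq_nonneg _)) (hsum θ).le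
  have hder : ∀ θ, HasDerivAt h
      ((ellipticDelta l θ + l ^ 2 * cos θ ^ 2 / ellipticDelta l θ) -
        (ellipticDelta k θ + k ^ 2 * cos θ ^ 2 / ellipticDelta k θ) - q θ) θ := by
    intro θ
    refine ((((hasDerivAt_sin θ).mul (hasDerivAt_cos θ)).const_mul (l ^ 2 - k ^ 2)).div
      ((hasDerivAt_ellipticDelta hk θ).add (hasDerivAt_ellipticDelta hl θ))
      (hsum θ).ne').congr_deriv ?_
    have ha := (ellipticDelta_pos hk θ).ne'
    have hb := (ellipticDelta_pos hl θ).ne'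
    have hab := (hsum θ).ne'
    have ha2 := ellipticDelta_sq hk θ
    have hb2 := ellipticDelta_sq hl θ
    have hsc := sin_sq_add_cos_sq θ
    simp only [hq, Pi.add_apply, Pi.mul_apply]
    generalize ellipticDelta k θ = a at *
    generalize ellipticDelta l θ = b at *
    generalize sin θ = s at *
    generalize cos θ = c at *
    have hX : (l ^ 2 - k ^ 2) * s ^ 2 - (a - b) * (a + b) = 0 := by
      linear_combination hb2 - ha2
    rw [← sub_eq_zero, ← mul_zero (-1 / (a + b) + c ^ 2 * (k ^ 2 / a + l ^ 2 / b) / (a + b) ^ 2),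
      ← hX]
    field_simp
    ring
  have key : ∫ θ in (0 : ℝ)..(π / 2),
      ((ellipticDelta l θ + l ^ 2 * cos θ ^ 2 / ellipticDelta l θ) -
        (ellipticDelta k θ + k ^ 2 * cos θ ^ 2 / ellipticDelta k θ) - q θ) = 0 := by
    rw [intervalIntegral.integral_eq_sub_of_hasDerivAt (fun θ _ => hder θ)
      ((((hc hl).sub (hc hk)).sub hqc).intervalIntegrable _ _)]
    simp [hh]
  have hsplit := intervalIntegral.integral_sub
    (((hc hl).sub (hc hk)).intervalIntegrable (μ := MeasureTheory.volume) 0 (π / 2))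
    (hqc.intervalIntegrable 0 (π / 2))
  simp only [Pi.sub_apply] at hsplit
  rw [hsplit, sub_eq_zero] at key
  rw [key]
  exact intervalIntegral.integral_nonneg (by positivity) fun θ _ => hq0 θ

theorem strictMonoOn_ellipticK_mul_ellipticD :
    StrictMonoOn (fun k => 2 * ellipticK k * ellipticD k) (Set.Ico 0 1) := by
  intro k hk l hl hkl
  have h2 : k ^ 2 < l ^ 2 := by nlinarith [hk.1]
  have hl2 : l ^ 2 < 1 := by nlinarith [hl.1, hl.2]
  have hK := ellipticK_lt h2 hl2
  have hD := ellipticD_le h2 hl2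
  have hK0 := ellipticK_pos (h2.trans hl2)
  have hD0 := ellipticD_pos (h2.trans hl2)
  simp only
  nlinarith [mul_pos (sub_pos.2 hK) hD0, mul_nonneg hK0.le (sub_nonneg.2 hD),
    mul_nonneg (sub_nonneg.2 hK.le) (sub_nonneg.2 hD)]

theorem ellipticK_zero : ellipticK 0 = π / 2 := by simp [ellipticK, ellipticF]

theorem ellipticD_zero : ellipticD 0 = π / 2 := by
  simp [ellipticD, ellipticK_zero, ellipticE]; ring

theorem continuousOn_ellipticK : ContinuousOn ellipticK (Set.Ico 0 1) := by
  rw [continuousOn_iff_continuous_domRestrict]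
  refine intervalIntegral.continuous_parametric_intervalIntegral_of_continuous'
    (f := fun (k : Set.Ico (0 : ℝ) 1) θ => 1 / ellipticDelta k θ) ?_ 0 (π / 2)
  refine continuous_const.div ?_ fun p => (ellipticDelta_pos ?_ _).ne'
  · simp only [ellipticDelta]; fun_prop
  · have := p.1.2.1; have := p.1.2.2; nlinarith

theorem continuous_ellipticE : Continuous ellipticE := by
  refine intervalIntegral.continuous_parametric_intervalIntegral_of_continuous'
    (f := fun k θ => ellipticDelta k θ) ?_ 0 (π / 2)
  simp only [ellipticDelta]; fun_prop

theorem continuousOn_ellipticD : ContinuousOn ellipticD (Set.Ico 0 1) :=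
  (continuous_ellipticE.continuousOn.const_mul 2).sub
    (continuousOn_ellipticK.mul (by fun_prop))

/-- With `k² = 1 - c²`, `Δ² = cos² θ + c² sin² θ ≤ (π/2 - θ + c)²`, and the reciprocal of this bound
integrates to a logarithm. Hence `K` is unbounded near modulus 1. -/
theorem log_le_ellipticK {c : ℝ} (hc : 0 < c) (hc1 : c ≤ 1) :
    log (π / 2 / c) ≤ ellipticK √(1 - c ^ 2) := by
  have hsq : √(1 - c ^ 2) ^ 2 = 1 - c ^ 2 := sq_sqrt (by nlinarith)
  have hk : √(1 - c ^ 2) ^ 2 < 1 := by rw [hsq]; nlinarith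
  have hpi := pi_pos
  have hpos : ∀ θ ∈ Set.Icc 0 (π / 2), 0 < π / 2 - θ + c := fun θ hθ => by linarith [hθ.2]
  have hint : IntervalIntegrable (fun θ => 1 / (π / 2 - θ + c)) MeasureTheory.volume 0 (π / 2) := by
    refine ContinuousOn.intervalIntegrable_of_Icc (by positivity) ?_
    exact continuousOn_const.div (by fun_prop) fun θ hθ => (hpos θ hθ).ne'
  have hval : ∫ θ in (0 : ℝ)..(π / 2), 1 / (π / 2 - θ + c) = log (π / 2 + c) - log c := by
    rw [intervalIntegral.integral_eq_sub_of_hasDerivAt (f := fun θ => -log (π / 2 - θ + c))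
      (fun θ hθ => ?_) hint]
    · simp; ring
    · rw [Set.uIcc_of_le (by positivity)] at hθ
      have := ((((hasDerivAt_id θ).const_sub (π / 2)).add_const c).log (hpos θ hθ).ne').neg
      exact this.congr_deriv (by simp [neg_div])
  calc log (π / 2 / c) = log (π / 2) - log c := log_div (by positivity) hc.ne'
    _ ≤ log (π / 2 + c) - log c := by
      gcongr; linarith
    _ = _ := hval.symm
    _ ≤ ellipticK √(1 - c ^ 2) := by
      refine intervalIntegral.integral_mono_on (by positivity) hint
        ((continuous_inv_ellipticDelta hk).intervalIntegrable _ _) fun θ hθ => ?_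
      refine one_div_le_one_div_of_le (ellipticDelta_pos hk θ) ?_
      refine sqrt_le_iff.2 ⟨(hpos θ hθ).le, ?_⟩
      have h0 : 0 ≤ cos θ := cos_nonneg_of_neg_pi_div_two_le_of_le (by linarith [hθ.1]) hθ.2
      have h1 : cos θ ≤ π / 2 - θ := by
        rw [← sin_pi_div_two_sub]; exact sin_le (by linarith [hθ.2])
      rw [hsq]
      nlinarith [sin_sq_add_cos_sq θ, sin_sq_le_one θ, mul_nonneg hc.le (h0.trans h1)]

theorem exists_ellipticK_mul_ellipticD_eq {r : ℝ} (hr : π ^ 2 / 2 < r) :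
    ∃ k ∈ Set.Ioo (0 : ℝ) 1, 2 * ellipticK k * ellipticD k = r := by
  have hpi := pi_pos
  have hr0 : 0 < r := lt_trans (by positivity) hr
  -- Chosen so that `log (π / 2 / c) = r + 1`; with `D ≥ 1`, `2KD` then exceeds `r` at the modulus
  -- `√(1 - c²)`.
  set c := π / 2 * exp (-(r + 1)) with hc
  have hc0 : 0 < c := by positivity
  have hc1 : c < 1 := by
    have h1 : π / 2 < exp (r + 1) := by
      nlinarith [add_one_le_exp (r + 1), pi_gt_three]
    rw [hc, exp_neg, ← div_eq_mul_inv, div_lt_one (exp_pos _)]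
    exact h1
  have hsq : √(1 - c ^ 2) ^ 2 = 1 - c ^ 2 := sq_sqrt (by nlinarith)
  have hK := log_le_ellipticK hc0 hc1.le
  have hlog : log (π / 2 / c) = r + 1 := by
    rw [hc, div_mul_cancel_left₀ (by positivity), ← exp_neg, neg_neg, log_exp]
  set b := √(1 - c ^ 2) with hb
  have hb0 : 0 ≤ b := sqrt_nonneg _
  have hb2 : b ^ 2 < 1 := by rw [hsq]; nlinarith
  have hb1 : b < 1 := by nlinarith
  have hD := one_le_ellipticD hb2
  have hcont : ContinuousOn (fun k => 2 * ellipticK k * ellipticD k) (Set.Icc 0 b) :=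
    ((continuousOn_ellipticK.const_mul 2).mul continuousOn_ellipticD).mono
      fun k hk => ⟨hk.1, hk.2.trans_lt hb1⟩
  have h0 : 2 * ellipticK 0 * ellipticD 0 = π ^ 2 / 2 := by
    rw [ellipticK_zero, ellipticD_zero]; ring
  obtain ⟨k, hk, hkr⟩ := intermediate_value_Icc hb0 hcont
    (show r ∈ Set.Icc _ _ from ⟨by simp only [h0]; exact hr.le, by nlinarith⟩)
  refine ⟨k, ⟨lt_of_le_of_ne hk.1 ?_, hk.2.trans_lt hb1⟩, hkr⟩
  rintro rfl
  simp only [h0] at hkr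
  exact hr.ne hkr

theorem pi_sq_div_two_lt {k : ℝ} (hk : k ∈ Set.Ioo (0 : ℝ) 1) :
    π ^ 2 / 2 < 2 * ellipticK k * ellipticD k := by
  have := strictMonoOn_ellipticK_mul_ellipticD ⟨le_rfl, one_pos⟩ ⟨hk.1.le, hk.2⟩ hk.1
  simp only [ellipticK_zero, ellipticD_zero] at this
  linarith

/-! ### Jacobi elliptic functions -/

theorem ellipticF_jacobiAm {k : ℝ} (hk : k ∈ Set.Ioo (0 : ℝ) 1) (u : ℝ) :
    ellipticF k (jacobiAm u k) = u :=
  Function.rightInverse_invFun (ellipticF_bijective hk).2 u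

theorem jacobiAm_ellipticF {k : ℝ} (hk : k ∈ Set.Ioo (0 : ℝ) 1) (φ : ℝ) :
    jacobiAm (ellipticF k φ) k = φ :=
  Function.leftInverse_invFun (ellipticF_bijective hk).1 φ

theorem jacobiAm_zero {k : ℝ} (hk : k ∈ Set.Ioo (0 : ℝ) 1) : jacobiAm 0 k = 0 := by
  simpa [ellipticF_zero] using jacobiAm_ellipticF hk 0

theorem jacobiAm_ellipticK {k : ℝ} (hk : k ∈ Set.Ioo (0 : ℝ) 1) :
    jacobiAm (ellipticK k) k = π / 2 :=
  jacobiAm_ellipticF hk (π / 2)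

theorem jacobiAm_add_two_mul_ellipticK {k : ℝ} (hk : k ∈ Set.Ioo (0 : ℝ) 1) (u : ℝ) :
    jacobiAm (u + 2 * ellipticK k) k = jacobiAm u k + π := by
  rw [← jacobiAm_ellipticF hk (jacobiAm u k + π), ellipticF_add_pi (sq_lt_one_of_mem_Ioo hk),
    ellipticF_jacobiAm hk]

theorem continuous_jacobiAm {k : ℝ} (hk : k ∈ Set.Ioo (0 : ℝ) 1) :
    Continuous fun u => jacobiAm u k := by
  have hmono := strictMono_ellipticF (sq_lt_one_of_mem_Ioo hk)
  have h := (hmono.orderIsoOfSurjective _ (ellipticF_bijective hk).2).symm.continuous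
  convert h using 1
  ext u
  refine hmono.injective ?_
  rw [ellipticF_jacobiAm hk]
  exact ((hmono.orderIsoOfSurjective _ (ellipticF_bijective hk).2).apply_symm_apply u).symm

theorem hasDerivAt_jacobiAm {k : ℝ} (hk : k ∈ Set.Ioo (0 : ℝ) 1) (u : ℝ) :
    HasDerivAt (fun u => jacobiAm u k) (jacobiDn u k) u := by
  have hk2 := sq_lt_one_of_mem_Ioo hk
  have h := HasDerivAt.of_local_left_inverse (continuous_jacobiAm hk).continuousAt
    (hasDerivAt_ellipticF hk2 (jacobiAm u k)) (one_div_pos.2 (ellipticDelta_pos hk2 _)).ne'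
    (Filter.Eventually.of_forall (ellipticF_jacobiAm hk))
  exact h.congr_deriv (by rw [one_div, inv_inv]; rfl)

theorem jacobiDn_pos {k : ℝ} (hk : k ∈ Set.Ioo (0 : ℝ) 1) (u : ℝ) : 0 < jacobiDn u k :=
  ellipticDelta_pos (sq_lt_one_of_mem_Ioo hk) _

theorem jacobiDn_sq {k : ℝ} (hk : k ∈ Set.Ioo (0 : ℝ) 1) (u : ℝ) :
    jacobiDn u k ^ 2 = 1 - k ^ 2 * jacobiSn u k ^ 2 :=
  ellipticDelta_sq (sq_lt_one_of_mem_Ioo hk) _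

theorem jacobiSn_sq_add_jacobiCn_sq (u k : ℝ) : jacobiSn u k ^ 2 + jacobiCn u k ^ 2 = 1 :=
  sin_sq_add_cos_sq _

theorem hasDerivAt_jacobiSn {k : ℝ} (hk : k ∈ Set.Ioo (0 : ℝ) 1) (u : ℝ) :
    HasDerivAt (fun u => jacobiSn u k) (jacobiCn u k * jacobiDn u k) u :=
  (hasDerivAt_jacobiAm hk u).sin

theorem hasDerivAt_jacobiCn {k : ℝ} (hk : k ∈ Set.Ioo (0 : ℝ) 1) (u : ℝ) :
    HasDerivAt (fun u => jacobiCn u k) (-jacobiSn u k * jacobiDn u k) u :=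
  (hasDerivAt_jacobiAm hk u).cos

theorem hasDerivAt_jacobiDn {k : ℝ} (hk : k ∈ Set.Ioo (0 : ℝ) 1) (u : ℝ) :
    HasDerivAt (fun u => jacobiDn u k) (-k ^ 2 * jacobiSn u k * jacobiCn u k) u := by
  have h := (hasDerivAt_ellipticDelta (sq_lt_one_of_mem_Ioo hk) (jacobiAm u k)).comp u
    (hasDerivAt_jacobiAm hk u)
  refine h.congr_deriv ?_
  change -(k ^ 2 * jacobiSn u k * jacobiCn u k) / jacobiDn u k * jacobiDn u k = _
  rw [div_mul_cancel₀ _ (jacobiDn_pos hk u).ne']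
  ring

/-- A shift by `2K` flips the sign of `cn` and keeps `dn`, so this constant product is what makes
`x(t) + x(t-1)` constant. -/
theorem jacobiDn_add_mul_jacobiDn_sub {k : ℝ} (hk : k ∈ Set.Ioo (0 : ℝ) 1) (u : ℝ) :
    (jacobiDn u k + k * jacobiCn u k) * (jacobiDn u k - k * jacobiCn u k) = 1 - k ^ 2 := by
  linear_combination jacobiDn_sq hk u - k ^ 2 * jacobiSn_sq_add_jacobiCn_sq u k

theorem jacobiDn_add_pos {k : ℝ} (hk : k ∈ Set.Ioo (0 : ℝ) 1) (u : ℝ) :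
    0 < jacobiDn u k + k * jacobiCn u k := by
  have h := jacobiDn_add_mul_jacobiDn_sub hk u
  have hd := jacobiDn_pos hk u
  have hk2 := sq_lt_one_of_mem_Ioo hk
  by_contra! hle
  nlinarith [mul_nonneg (neg_nonneg.2 hle) (show 0 ≤ jacobiDn u k - k * jacobiCn u k by linarith)]

/-! ### The function `2 log(dn + k cn)` and its minimal period -/

/-- The function `2 log (dn + k cn)`, which solves a sinh-type pendulum equation. -/
def logDnCn (k u : ℝ) : ℝ := 2 * log (jacobiDn u k + k * jacobiCn u k)

theorem exp_logDnCn {k : ℝ} (hk : k ∈ Set.Ioo (0 : ℝ) 1) (u : ℝ) :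
    exp (logDnCn k u) = (jacobiDn u k + k * jacobiCn u k) ^ 2 := by
  rw [logDnCn, two_mul, exp_add, exp_log (jacobiDn_add_pos hk u)]
  ring

theorem hasDerivAt_logDnCn {k : ℝ} (hk : k ∈ Set.Ioo (0 : ℝ) 1) (u : ℝ) :
    HasDerivAt (logDnCn k) (-2 * k * jacobiSn u k) u := by
  have hp := (jacobiDn_add_pos hk u).ne'
  have h := (((hasDerivAt_jacobiDn hk u).add ((hasDerivAt_jacobiCn hk u).const_mul k)).log
    hp).const_mul 2
  refine h.congr_deriv ?_
  simp only [Pi.add_apply]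
  field_simp
  ring

theorem logDnCn_add_four_mul_ellipticK {k : ℝ} (hk : k ∈ Set.Ioo (0 : ℝ) 1) :
    Function.Periodic (logDnCn k) (4 * ellipticK k) := by
  intro u
  have h : jacobiAm (u + 4 * ellipticK k) k = jacobiAm u k + π + π := by
    rw [← jacobiAm_add_two_mul_ellipticK hk, ← jacobiAm_add_two_mul_ellipticK hk]
    congr 1; ring
  simp [logDnCn, jacobiDn, jacobiSn, jacobiCn, h, sin_add_pi, cos_add_pi]

theorem logDnCn_zero {k : ℝ} (hk : k ∈ Set.Ioo (0 : ℝ) 1) : logDnCn k 0 = 2 * log (1 + k) := by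
  simp [logDnCn, jacobiDn, jacobiSn, jacobiCn, jacobiAm_zero hk]

theorem jacobiSn_sub_two_mul_ellipticK {k : ℝ} (hk : k ∈ Set.Ioo (0 : ℝ) 1) (u : ℝ) :
    jacobiSn (u - 2 * ellipticK k) k = -jacobiSn u k := by
  have h := jacobiAm_add_two_mul_ellipticK hk (u - 2 * ellipticK k)
  rw [sub_add_cancel] at h
  rw [jacobiSn, jacobiSn, h, sin_add_pi, neg_neg]

theorem jacobiCn_sub_two_mul_ellipticK {k : ℝ} (hk : k ∈ Set.Ioo (0 : ℝ) 1) (u : ℝ) :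
    jacobiCn (u - 2 * ellipticK k) k = -jacobiCn u k := by
  have h := jacobiAm_add_two_mul_ellipticK hk (u - 2 * ellipticK k)
  rw [sub_add_cancel] at h
  rw [jacobiCn, jacobiCn, h, cos_add_pi, neg_neg]

theorem logDnCn_add_logDnCn_sub {k : ℝ} (hk : k ∈ Set.Ioo (0 : ℝ) 1) (u : ℝ) :
    logDnCn k u + logDnCn k (u - 2 * ellipticK k) = 2 * log (1 - k ^ 2) := by
  have hp := jacobiDn_add_pos hk u
  have hk2 := sq_lt_one_of_mem_Ioo hk
  have hq : jacobiDn u k - k * jacobiCn u k ≠ 0 := by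
    intro h
    have := jacobiDn_add_mul_jacobiDn_sub hk u
    rw [h, mul_zero] at this
    linarith
  have hdn : jacobiDn (u - 2 * ellipticK k) k = jacobiDn u k := by
    rw [jacobiDn, jacobiDn, jacobiSn_sub_two_mul_ellipticK hk, neg_sq]
  rw [← jacobiDn_add_mul_jacobiDn_sub hk u, log_mul hp.ne' hq, logDnCn, logDnCn, hdn,
    jacobiCn_sub_two_mul_ellipticK hk]
  ring_nf

/-- The minimal period of `2 log (dn + k cn)` is `4 K`. -/
theorem isLeast_period_logDnCn {k : ℝ} (hk : k ∈ Set.Ioo (0 : ℝ) 1) :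
    IsLeast {T : ℝ | 0 < T ∧ Function.Periodic (logDnCn k) T} (4 * ellipticK k) := by
  have hk2 := sq_lt_one_of_mem_Ioo hk
  have hK := ellipticK_pos hk2
  refine ⟨⟨by positivity, logDnCn_add_four_mul_ellipticK hk⟩, ?_⟩
  rintro T ⟨hT, hper⟩
  by_contra! hlt
  -- The derivative vanishes at `0`, hence at any period `T`. For `0 < T < 4K` this leaves only
  -- amplitude `π`, where the value is `2 log(1 - k)` instead of `2 log(1 + k)`.
  have hder : -2 * k * jacobiSn T k = -2 * k * jacobiSn 0 k := by
    have h1 : HasDerivAt (fun u => logDnCn k (u + T)) (-2 * k * jacobiSn (0 + T) k) 0 :=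
      HasDerivAt.comp_add_const 0 T (hasDerivAt_logDnCn hk _)
    have h2 : (fun u => logDnCn k (u + T)) = logDnCn k := funext hper
    rw [h2, zero_add] at h1
    exact h1.unique (hasDerivAt_logDnCn hk 0)
  have hsn : sin (jacobiAm T k) = 0 := by
    have h0 : jacobiSn 0 k = 0 := by rw [jacobiSn, jacobiAm_zero hk, sin_zero]
    rw [h0, mul_zero] at hder
    have := hk.1.ne'
    simpa [this, jacobiSn] using hder
  have hF := strictMono_ellipticF hk2
  have hF2 : ellipticF k π = 2 * ellipticK k := by
    simpa [ellipticF_zero] using ellipticF_add_pi hk2 0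
  have h0 : 0 < jacobiAm T k := by
    rw [← hF.lt_iff_lt, ellipticF_zero, ellipticF_jacobiAm hk]; exact hT
  have h2 : jacobiAm T k < π + π := by
    rw [← hF.lt_iff_lt, ellipticF_add_pi hk2, hF2, ellipticF_jacobiAm hk]; linarith
  obtain ⟨n, hn⟩ := sin_eq_zero_iff.1 hsn
  have hpi := pi_pos
  have hn0 : (0 : ℝ) < n := by
    by_contra! h
    nlinarith
  have hn2 : (n : ℝ) < 2 := by
    by_contra! h
    nlinarith
  have hn1 : n = 1 := by
    have : 0 < n := by exact_mod_cast hn0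
    have : n < 2 := by exact_mod_cast hn2
    omega
  have ham : jacobiAm T k = π := by rw [← hn, hn1]; simp
  have heq := hper 0
  rw [zero_add, logDnCn_zero hk] at heq
  simp only [logDnCn, jacobiDn, jacobiSn, jacobiCn, ham] at heq
  have h1k : 0 < 1 - k := by linarith [hk.2]
  have hlog : log (1 - k) < log (1 + k) := log_lt_log h1k (by linarith [hk.1])
  simp [← sub_eq_add_neg] at heq
  linarith

theorem isLeast_period_comp_affine {f : ℝ → ℝ} {T ω : ℝ} (hω : 0 < ω) (a b : ℝ)
    (hT : IsLeast {T : ℝ | 0 < T ∧ Function.Periodic f T} T) :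
    IsLeast {T : ℝ | 0 < T ∧ Function.Periodic (fun t => a + f (ω * t + b)) T} (T / ω) := by
  refine ⟨⟨div_pos hT.1.1 hω, fun t => ?_⟩, ?_⟩
  · simp only
    rw [← hT.1.2 (ω * t + b), mul_add, mul_div_cancel₀ _ hω.ne', add_right_comm]
  · rintro S ⟨hS, hper⟩
    rw [div_le_iff₀ hω]
    refine hT.2 ⟨by positivity, fun u => ?_⟩
    have h := hper ((u - b) / ω)
    simp only [add_right_inj] at h
    rwa [mul_add, mul_div_cancel₀ _ hω.ne', add_right_comm, sub_add_cancel, mul_comm ω S] at h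

/-! ### The delayed integral along the profile -/

/-- A primitive of `(dn + k cn)²`. -/
def dnCnPrimitive (k u : ℝ) : ℝ :=
  2 * ellipticEInc k (jacobiAm u k) - (1 - k ^ 2) * u + 2 * k * jacobiSn u k

theorem hasDerivAt_dnCnPrimitive {k : ℝ} (hk : k ∈ Set.Ioo (0 : ℝ) 1) (u : ℝ) :
    HasDerivAt (dnCnPrimitive k) (exp (logDnCn k u)) u := by
  have h1 := (hasDerivAt_ellipticEInc k (jacobiAm u k)).comp u (hasDerivAt_jacobiAm hk u)
  have h := ((h1.const_mul 2).sub ((hasDerivAt_id u).const_mul (1 - k ^ 2))).add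
    ((hasDerivAt_jacobiSn hk u).const_mul (2 * k))
  refine h.congr_deriv ?_
  rw [exp_logDnCn hk]
  change 2 * (jacobiDn u k * jacobiDn u k) - (1 - k ^ 2) * 1 + _ = _
  linear_combination jacobiDn_sq hk u - k ^ 2 * jacobiSn_sq_add_jacobiCn_sq u k

/-- The increments `2E` of the second-kind integral and `2K` of `u` combine into `D`, while `sn`
changes sign. This makes the feedback affine in `sn`, as the derivative of the profile is. -/
theorem dnCnPrimitive_sub {k : ℝ} (hk : k ∈ Set.Ioo (0 : ℝ) 1) (u : ℝ) :
    dnCnPrimitive k u - dnCnPrimitive k (u - 2 * ellipticK k) =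
      2 * ellipticD k + 4 * k * jacobiSn u k := by
  have h := jacobiAm_add_two_mul_ellipticK hk (u - 2 * ellipticK k)
  rw [sub_add_cancel] at h
  rw [dnCnPrimitive, dnCnPrimitive, jacobiSn_sub_two_mul_ellipticK hk, h, ellipticEInc_add_pi,
    ellipticD]
  ring

/-- The delayed feedback term along a translate of the profile with frequency `2 K`. -/
theorem integral_feedback {k : ℝ} (hk : k ∈ Set.Ioo (0 : ℝ) 1) (r a b t : ℝ) :
    ∫ s in (0 : ℝ)..1, r * (exp (a + logDnCn k (2 * ellipticK k * (t - s) + b)) - 1) =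
      r * (exp a / (2 * ellipticK k) *
        (2 * ellipticD k + 4 * k * jacobiSn (2 * ellipticK k * t + b) k) - 1) := by
  have hK := ellipticK_pos (sq_lt_one_of_mem_Ioo hk)
  set K := ellipticK k with hKdef
  have hd : ∀ s, HasDerivAt
      (fun s => r * (-(exp a / (2 * K)) * dnCnPrimitive k (2 * K * (t - s) + b) - s))
      (r * (exp (a + logDnCn k (2 * K * (t - s) + b)) - 1)) s := by
    intro s
    have hin : HasDerivAt (fun s => 2 * K * (t - s) + b) (2 * K * -1) s :=
      (((hasDerivAt_id s).const_sub t).const_mul (2 * K)).add_const b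
    have h := ((((hasDerivAt_dnCnPrimitive hk _).comp s hin).const_mul
      (-(exp a / (2 * K)))).sub (hasDerivAt_id s)).const_mul r
    refine h.congr_deriv ?_
    rw [exp_add]
    field_simp
  have hc : Continuous fun s => r * (exp (a + logDnCn k (2 * K * (t - s) + b)) - 1) := by
    have : Continuous (logDnCn k) :=
      continuous_iff_continuousAt.2 fun u => (hasDerivAt_logDnCn hk u).continuousAt
    fun_prop
  rw [intervalIntegral.integral_eq_sub_of_hasDerivAt (fun s _ => hd s)
    (hc.intervalIntegrable _ _), ← dnCnPrimitive_sub hk, ← hKdef]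
  rw [show 2 * K * (t - 1) + b = 2 * K * t + b - 2 * K by ring, sub_zero]
  ring_nf

theorem hasDerivAt_profile {k : ℝ} (hk : k ∈ Set.Ioo (0 : ℝ) 1) (a ω b t : ℝ) :
    HasDerivAt (fun t => a + logDnCn k (ω * t + b)) (-2 * k * ω * jacobiSn (ω * t + b) k) t := by
  have hin : HasDerivAt (fun t => ω * t + b) (ω * 1) t :=
    ((hasDerivAt_id t).const_mul ω).add_const b
  exact (((hasDerivAt_logDnCn hk _).comp t hin).const_add a).congr_deriv (by ring)

theorem logisticProfile_eq {k : ℝ} (hk : k ∈ Set.Ioo (0 : ℝ) 1) (t : ℝ) :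
    logisticProfile k t =
      log (ellipticK k / ellipticD k) + logDnCn k (2 * ellipticK k * t) := by
  have hk2 := sq_lt_one_of_mem_Ioo hk
  have h1 := ellipticK_pos hk2
  have h2 := ellipticD_pos hk2
  have h3 := jacobiDn_add_pos hk (2 * ellipticK k * t)
  rw [logisticProfile, ← ellipticD, mul_div_right_comm, log_mul (by positivity) (by positivity),
    log_pow, logDnCn]
  norm_num

theorem isSSPS_logisticProfile {k r : ℝ} (hk : k ∈ Set.Ioo (0 : ℝ) 1)
    (hr : r = 2 * ellipticK k * ellipticD k) :
    IsSSPS (fun u => r * (exp u - 1)) (logisticProfile k) := by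
  have hk2 := sq_lt_one_of_mem_Ioo hk
  have hK := ellipticK_pos hk2
  have hD := ellipticD_pos hk2
  have hx : logisticProfile k =
      fun t => log (ellipticK k / ellipticD k) + logDnCn k (2 * ellipticK k * t + 0) := by
    ext t; rw [logisticProfile_eq hk, add_zero]
  rw [hx]
  refine ⟨fun t => ?_, ?_, ?_⟩
  · refine (hasDerivAt_profile hk _ _ _ t).congr_deriv ?_
    rw [integral_feedback hk, exp_log (div_pos hK hD), hr]
    field_simp
    ring
  · have h := isLeast_period_comp_affine (ω := 2 * ellipticK k) (by positivity)
      (log (ellipticK k / ellipticD k)) 0 (isLeast_period_logDnCn hk)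
    rwa [show 4 * ellipticK k / (2 * ellipticK k) = 2 by field_simp; norm_num] at h
  · refine ⟨2 * log (ellipticK k / ellipticD k) + 2 * log (1 - k ^ 2), fun t => ?_⟩
    rw [← logDnCn_add_logDnCn_sub hk (2 * ellipticK k * t + 0),
      show 2 * ellipticK k * (t - 1) + 0 = 2 * ellipticK k * t + 0 - 2 * ellipticK k by ring]
    ring

/-- A member of the family `a + 2 log (dn + k cn)(2 K t + b)` solves the delay equation only if
its amplitude and modulus are the right ones. -/
theorem eq_of_isDelaySolution {k r a b : ℝ} (hk : k ∈ Set.Ioo (0 : ℝ) 1) (hr0 : 0 < r)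
    (h : IsDelaySolution (fun u => r * (exp u - 1))
      (fun t => a + logDnCn k (2 * ellipticK k * t + b))) :
    a = log (ellipticK k / ellipticD k) ∧ r = 2 * ellipticK k * ellipticD k := by
  have hk2 := sq_lt_one_of_mem_Ioo hk
  have hK := ellipticK_pos hk2
  have hD := ellipticD_pos hk2
  have heq : ∀ u, -2 * k * (2 * ellipticK k) * jacobiSn u k =
      -(r * (exp a / (2 * ellipticK k) * (2 * ellipticD k + 4 * k * jacobiSn u k) - 1)) := by
    intro u
    have h1 := (h ((u - b) / (2 * ellipticK k))).unique (hasDerivAt_profile hk _ _ _ _)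
    rw [integral_feedback hk, mul_div_cancel₀ _ (by positivity), sub_add_cancel] at h1
    exact h1.symm
  -- Both sides are affine in `sn`; the points `0` and `K`, where `sn` is `0` and `1`, separate the
  -- two coefficients.
  have h0 := heq 0
  have h1 := heq (ellipticK k)
  simp only [jacobiSn, jacobiAm_zero hk, jacobiAm_ellipticK hk, sin_zero, sin_pi_div_two] at h0 h1
  have hA : exp a = ellipticK k / ellipticD k := by
    have : exp a / (2 * ellipticK k) * (2 * ellipticD k) = 1 := by
      have : r * (exp a / (2 * ellipticK k) * (2 * ellipticD k) - 1) = 0 := by linarith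
      rcases mul_eq_zero.1 this with h | h
      · exact absurd h hr0.ne'
      · linarith
    field_simp at this ⊢
    linarith
  refine ⟨by rw [← hA, log_exp], ?_⟩
  rw [hA] at h1
  have hk0 := hk.1.ne'
  field_simp at h1
  have : k * (r - 2 * ellipticK k * ellipticD k) = 0 := by linear_combination (1 / 4) * h1
  rcases mul_eq_zero.1 this with h | h
  · exact absurd h hk0
  · linarith

/-! ### Reduction to the second-order equation and classification -/

/-- Uniqueness for the autonomous second-order equation `y'' = g(y)` among bounded solutions. -/
theorem secondOrder_solution_unique {g : ℝ → ℝ} (hg : ContDiff ℝ 1 g) {y z p q : ℝ → ℝ}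
    (hy : ∀ t, HasDerivAt y (p t) t) (hp : ∀ t, HasDerivAt p (g (y t)) t)
    (hz : ∀ t, HasDerivAt z (q t) t) (hq : ∀ t, HasDerivAt q (g (z t)) t)
    {B : ℝ} (hyB : ∀ t, y t ∈ Set.Icc (-B) B) (hzB : ∀ t, z t ∈ Set.Icc (-B) B)
    {t₀ : ℝ} (h0 : y t₀ = z t₀) (h1 : p t₀ = q t₀) : y = z := by
  -- A `C¹` function such as an exponential need not be globally Lipschitz; boundedness confines
  -- both solutions to a compact interval, where it is.
  obtain ⟨L, hL⟩ := hg.locallyLipschitz.locallyLipschitzOn.exists_lipschitzOnWith_of_compact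
    (isCompact_Icc (a := -B) (b := B))
  have hv : LipschitzOnWith (max 1 (L * 1)) (fun w : ℝ × ℝ => (w.2, g w.1))
      (Set.Icc (-B) B ×ˢ Set.univ) := by
    refine LipschitzOnWith.prodMk LipschitzWith.prod_snd.lipschitzOnWith ?_
    exact hL.comp LipschitzWith.prod_fst.lipschitzOnWith fun w hw => hw.1
  have h := ODE_solution_unique_univ (v := fun _ (w : ℝ × ℝ) => (w.2, g w.1))
    (s := fun _ => Set.Icc (-B) B ×ˢ Set.univ)
    (f := fun t => (y t, p t)) (g := fun t => (z t, q t)) (t₀ := t₀) (fun _ => hv)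
    (fun t => ⟨(hy t).prodMk (hp t), hyB t, trivial⟩)
    (fun t => ⟨(hz t).prodMk (hq t), hzB t, trivial⟩) (by simp [h0, h1])
  exact funext fun t => congrArg Prod.fst (congrFun h t)

theorem exists_abs_le_of_periodic {y : ℝ → ℝ} (hy : Continuous y) {T : ℝ} (hT : T ≠ 0)
    (hper : Function.Periodic y T) : ∃ B, ∀ t, |y t| ≤ B := by
  obtain ⟨B, hB⟩ := (hper.isBounded_of_continuous hT hy).exists_norm_le
  exact ⟨B, fun t => hB _ ⟨t, rfl⟩⟩

theorem exists_forall_le_of_periodic {y : ℝ → ℝ} (hy : Continuous y) {T : ℝ} (hT : T ≠ 0)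
    (hper : Function.Periodic y T) : ∃ t₁, ∀ t, y t ≤ y t₁ := by
  obtain ⟨_, ⟨t₁, rfl⟩, h⟩ :=
    (hper.compact_of_continuous hT hy).exists_isGreatest (Set.range_nonempty y)
  exact ⟨t₁, fun t => h ⟨t, rfl⟩⟩

theorem IsDelaySolution.continuous {f x : ℝ → ℝ} (h : IsDelaySolution f x) : Continuous x :=
  continuous_iff_continuousAt.2 fun t => (h t).continuousAt

/-- The delayed integral is `∫ f(x)` over the moving window `[t-1, t]`, so only its endpoints
contribute. -/
theorem IsDelaySolution.hasDerivAt_deriv {f x : ℝ → ℝ} (hf : Continuous f)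
    (h : IsDelaySolution f x) (t : ℝ) :
    HasDerivAt (fun t => -∫ s in (0 : ℝ)..1, f (x (t - s))) (-(f (x t) - f (x (t - 1)))) t := by
  have hc : Continuous fun u => f (x u) := hf.comp h.continuous
  have heq : (fun t => -∫ s in (0 : ℝ)..1, f (x (t - s))) =
      fun t => -((∫ u in (0 : ℝ)..t, f (x u)) - ∫ u in (0 : ℝ)..(t - 1), f (x u)) := by
    ext t
    rw [intervalIntegral.integral_comp_sub_left (fun u => f (x u)) t, sub_zero,
      intervalIntegral.integral_interval_sub_left (hc.intervalIntegrable _ _)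
        (hc.intervalIntegrable _ _)]
  rw [heq]
  have hG : ∀ u, HasDerivAt (fun u => ∫ v in (0 : ℝ)..u, f (x v)) (f (x u)) u := fun u =>
    (hc.integral_hasStrictDerivAt 0 u).hasDerivAt
  exact ((hG t).sub ((hG (t - 1)).comp_sub_const t 1)).neg

/-- The profile solves the second-order equation obtained by differentiating the delay equation. -/
theorem hasDerivAt_deriv_profile {k : ℝ} (hk : k ∈ Set.Ioo (0 : ℝ) 1) {r c a ω : ℝ}
    (ha : exp a * (1 - k ^ 2) = exp (c / 2))
    (hω : ω ^ 2 * (1 - k ^ 2) = 2 * r * exp (c / 2)) (b t : ℝ) :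
    HasDerivAt (fun t => -2 * k * ω * jacobiSn (ω * t + b) k)
      (-(r * (exp (a + logDnCn k (ω * t + b)) - 1) -
        r * (exp (c - (a + logDnCn k (ω * t + b))) - 1))) t := by
  have hk2 : (1 - k ^ 2) ≠ 0 := by have := sq_lt_one_of_mem_Ioo hk; linarith
  have hin : HasDerivAt (fun t => ω * t + b) (ω * 1) t :=
    ((hasDerivAt_id t).const_mul ω).add_const b
  refine (((hasDerivAt_jacobiSn hk _).comp t hin).const_mul (-2 * k * ω)).congr_deriv ?_
  set u := ω * t + b
  have hp := (jacobiDn_add_pos hk u).ne'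
  have hprod := jacobiDn_add_mul_jacobiDn_sub hk u
  have hc : exp c = exp (c / 2) ^ 2 := by rw [← exp_nat_mul]; congr 1; push_cast; ring
  -- Reflection about `c/2` replaces `dn + k cn` by its conjugate, and the difference of the two
  -- squares is `4k dn cn`, proportional to the derivative of `sn`.
  have he : exp (c - (a + logDnCn k u)) = exp a * (jacobiDn u k - k * jacobiCn u k) ^ 2 := by
    rw [exp_sub, exp_add, exp_logDnCn hk, hc, ← ha, ← hprod]
    have := (exp_pos a).ne'
    field_simp
  rw [he, exp_add, exp_logDnCn hk]
  have hω2 : ω ^ 2 = 2 * r * exp a := by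
    apply mul_right_cancel₀ hk2
    rw [hω, ← ha]; ring
  linear_combination (-2 * k * jacobiCn u k * jacobiDn u k) * hω2

theorem IsSSPS.exists_eq_logisticProfile {r : ℝ} (hr : 0 < r) {x : ℝ → ℝ}
    (hx : IsSSPS (fun u => r * (exp u - 1)) x) :
    ∃ k ∈ Set.Ioo (0 : ℝ) 1, r = 2 * ellipticK k * ellipticD k ∧
      ∃ t₀, ∀ t, x t = logisticProfile k (t + t₀) := by
  obtain ⟨hsol, hper, c, hc⟩ := hx
  have hxc := hsol.continuous
  obtain ⟨t₁, ht₁⟩ := exists_forall_le_of_periodic hxc two_ne_zero hper.1.2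
  -- Otherwise `x ≤ c/2` everywhere while `x(t) + x(t-1) = c`, so `x` is constant and has the
  -- smaller period 1.
  have hM : c / 2 < x t₁ := by
    by_contra! hle
    have hconst : ∀ t, x t = c / 2 := fun t => by
      linarith [hc t, (ht₁ t).trans hle, (ht₁ (t - 1)).trans hle]
    have := hper.2 (show (1 : ℝ) ∈ _ from ⟨one_pos, fun t => by rw [hconst, hconst]⟩)
    norm_num at this
  set q := exp (x t₁ - c / 2) with hq
  have hq1 : 1 < q := by rw [hq]; exact one_lt_exp_iff.2 (by linarith)
  -- Solves `q = (1 + k)/(1 - k)`: the maximum `2 log(1 + k)` lies `log((1 + k)/(1 - k))` above the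
  -- midvalue `log(1 - k²)`, and this must equal `x t₁ - c/2`.
  set k := (q - 1) / (q + 1) with hkdef
  have hk : k ∈ Set.Ioo (0 : ℝ) 1 :=
    ⟨div_pos (by linarith) (by linarith), (div_lt_one (by linarith)).2 (by linarith)⟩
  have hk2 : 0 < 1 - k ^ 2 := sub_pos.2 (sq_lt_one_of_mem_Ioo hk)
  have hkq : q * (1 - k) = 1 + k := by
    have : q + 1 ≠ 0 := by linarith
    rw [hkdef]; field_simp; ring
  have h1k : 0 < 1 + k := by linarith [hk.1]
  set a := x t₁ - logDnCn k 0 with ha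
  have hea : exp a * (1 - k ^ 2) = exp (c / 2) := by
    have h2 : exp (2 * log (1 + k)) = (1 + k) ^ 2 := by
      rw [two_mul, exp_add, exp_log h1k]; ring
    have h3 : exp (x t₁) = q * exp (c / 2) := by rw [hq, ← exp_add]; congr 1; ring
    rw [ha, logDnCn_zero hk, exp_sub, h2, h3, div_mul_eq_mul_div, div_eq_iff (by positivity)]
    linear_combination (exp (c / 2) * (1 + k)) * hkq
  set ω := √(2 * r * exp (c / 2) / (1 - k ^ 2)) with hωdef
  have hω0 : 0 < ω := sqrt_pos.2 (by positivity)
  have hω : ω ^ 2 * (1 - k ^ 2) = 2 * r * exp (c / 2) := by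
    rw [hωdef, sq_sqrt (by positivity), div_mul_cancel₀ _ hk2.ne']
  have hzd := hasDerivAt_profile hk a ω (-(ω * t₁))
  have hzc : Continuous fun t => a + logDnCn k (ω * t + -(ω * t₁)) :=
    continuous_iff_continuousAt.2 fun t => (hzd t).continuousAt
  have hzper := isLeast_period_comp_affine hω0 a (-(ω * t₁)) (isLeast_period_logDnCn hk)
  obtain ⟨B₁, hB₁⟩ := exists_abs_le_of_periodic hxc two_ne_zero hper.1.2
  obtain ⟨B₂, hB₂⟩ := exists_abs_le_of_periodic hzc hzper.1.1.ne' hzper.1.2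
  have hxz : x = fun t => a + logDnCn k (ω * t + -(ω * t₁)) := by
    refine secondOrder_solution_unique
      (g := fun u => -(r * (exp u - 1) - r * (exp (c - u) - 1))) (by fun_prop) hsol
      (fun t => ?_) hzd (hasDerivAt_deriv_profile hk hea hω _)
      (fun t => abs_le.1 ((hB₁ t).trans (le_max_left B₁ B₂)))
      (fun t => abs_le.1 ((hB₂ t).trans (le_max_right B₁ B₂))) (t₀ := t₁) ?_ ?_
    · have h := hsol.hasDerivAt_deriv (by fun_prop) t
      rwa [show x (t - 1) = c - x t by linarith [hc t]] at h
    · simp [ha]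
    · have hmax : IsLocalMax x t₁ := Filter.Eventually.of_forall ht₁
      rw [hmax.hasDerivAt_eq_zero (hsol t₁)]
      simp [jacobiSn, jacobiAm_zero hk]
  -- Least periods are unique, so `4K/ω = 2`.
  have hωK : ω = 2 * ellipticK k := by
    rw [← hxz] at hzper
    have h := hzper.unique hper
    rw [div_eq_iff hω0.ne'] at h
    linarith
  rw [hωK] at hxz
  rw [hxz] at hsol
  obtain ⟨h1, h2⟩ := eq_of_isDelaySolution hk hr hsol
  refine ⟨k, hk, h2, -t₁, fun t => ?_⟩
  rw [hxz, logisticProfile_eq hk]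
  simp only
  rw [h1]
  congr 2
  ring

end

theorem theorem5 (r : ℝ) (hr : 0 < r) :
    ((∃ x : ℝ → ℝ, IsSSPS (fun u => r * (Real.exp u - 1)) x) ↔ Real.pi ^ 2 / 2 < r) ∧
    (Real.pi ^ 2 / 2 < r →
      (∃! k : ℝ, k ∈ Set.Ioo (0 : ℝ) 1 ∧
        r = 2 * ellipticK k * (2 * ellipticE k - ellipticK k * (1 - k ^ 2))) ∧
      ∀ k ∈ Set.Ioo (0 : ℝ) 1,
        r = 2 * ellipticK k * (2 * ellipticE k - ellipticK k * (1 - k ^ 2)) →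
        IsSSPS (fun u => r * (Real.exp u - 1)) (logisticProfile k) ∧
        ∀ x : ℝ → ℝ, IsSSPS (fun u => r * (Real.exp u - 1)) x →
          ∃ t₀ : ℝ, ∀ t : ℝ, x t = logisticProfile k (t + t₀)) := by
  have huniq : ∀ k ∈ Set.Ioo (0 : ℝ) 1, ∀ l ∈ Set.Ioo (0 : ℝ) 1,
      r = 2 * ellipticK k * ellipticD k → r = 2 * ellipticK l * ellipticD l → k = l :=
    fun k hk l hl h1 h2 => strictMonoOn_ellipticK_mul_ellipticD.injOn ⟨hk.1.le, hk.2⟩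
      ⟨hl.1.le, hl.2⟩ (h1.symm.trans h2)
  refine ⟨⟨?_, fun h => ?_⟩, fun h => ⟨?_, fun k hk hkr => ⟨isSSPS_logisticProfile hk hkr, ?_⟩⟩⟩
  · rintro ⟨x, hx⟩
    obtain ⟨k, hk, hkr, -⟩ := hx.exists_eq_logisticProfile hr
    rw [hkr]
    exact pi_sq_div_two_lt hk
  · obtain ⟨k, hk, hkr⟩ := exists_ellipticK_mul_ellipticD_eq h
    exact ⟨_, isSSPS_logisticProfile hk hkr.symm⟩
  · obtain ⟨k, hk, hkr⟩ := exists_ellipticK_mul_ellipticD_eq h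
    exact ⟨k, ⟨hk, hkr.symm⟩, fun l hl => huniq l hl.1 k hk hl.2 hkr.symm⟩
  · intro x hx
    obtain ⟨l, hl, hlr, t₀, ht₀⟩ := hx.exists_eq_logisticProfile hr
    rw [huniq l hl k hk hlr hkr] at ht₀
    exact ⟨t₀, ht₀⟩
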